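/- Let $G$ be a compact topological group and let $D > 0$ be a real number. Assume that $G$ is $D$-quasi-random, i.e. that every continuous complex representation $G \to \mathrm{GL}_n(\mathbb{C})$ of dimension $n < D$ is trivial. Let $\pi$ be a strongly continuous unitary representation of $G$ on a complex Hilbert space $V$ (of arbitrary dimension). For any unitary representation $\sigma$ of $G$ on a Hilbert space $H$, let $P^\circ_\sigma : H \to H$ denote the orthogonal projection onto the closed subspace of $\sigma$-fixed vectors. Let $V \otimes V$ be the Hilbert space tensor product, and let $\pi\otimes\pi$ be the unitary representation on it determined by $(\pi\otimes\pi)^g(x\otimes y) = \pi^g x\otimes \pi^g y$. Then for all $u, v \in V$, \[ \big\| P^\circ_{\pi\otimes\pi}(u\otimes v) - P^\circ_\pi u\otimes P^\circ_\pi v \big\|_{V\otimes V} \le D^{-1/2}\,\|u\|_V\,\|v\|_V . \] -/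

import Mathlib

open scoped TensorProduct

/-- A topological group `G` is `D`-quasi-random if every (continuous, complex, finite-dimensional)
representation of `G` of dimension less than `D` is trivial. -/
def IsQuasiRandom (G : Type*) [Group G] [TopologicalSpace G] (D : ℝ) : Prop :=
  ∀ n : ℕ, (n : ℝ) < D → ∀ ρ : G →* Matrix.GeneralLinearGroup (Fin n) ℂ, Continuous ρ → ρ = 1

/-- A unitary representation of a topological group `G` on a complex inner product space `V`:
a homomorphism from `G` to the group of unitary operators of `V` that is strongly continuous. -/
structure UnitaryRep (G V : Type*) [Group G] [TopologicalSpace G]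
    [NormedAddCommGroup V] [InnerProductSpace ℂ V] where
  /-- The underlying homomorphism to the unitary group of `V`. -/
  toHom : G →* (V ≃ₗᵢ[ℂ] V)
  /-- Every orbit map is continuous. -/
  continuous_apply : ∀ v : V, Continuous fun g : G => toHom g v

/-- The Hilbert space tensor product: the completion of the algebraic tensor product for the inner
product with `⟪v ⊗ₜ w, v' ⊗ₜ w'⟫ = ⟪v, v'⟫ * ⟪w, w'⟫`. -/
abbrev HilbertTensor (V W : Type*) [NormedAddCommGroup V] [InnerProductSpace ℂ V]
    [NormedAddCommGroup W] [InnerProductSpace ℂ W] : Type _ :=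
  UniformSpace.Completion (V ⊗[ℂ] W)

/-- The elementary tensor `v ⊗ w` in the Hilbert space tensor product. -/
noncomputable def htmul {V W : Type*} [NormedAddCommGroup V] [InnerProductSpace ℂ V]
    [NormedAddCommGroup W] [InnerProductSpace ℂ W] (v : V) (w : W) : HilbertTensor V W :=
  ((v ⊗ₜ[ℂ] w : V ⊗[ℂ] W) : UniformSpace.Completion (V ⊗[ℂ] W))

/-- The extension of a unitary operator of an inner product space to the completion. -/
noncomputable def completionIsometry {E : Type*} [NormedAddCommGroup E] [InnerProductSpace ℂ E]
    (f : E ≃ₗᵢ[ℂ] E) : UniformSpace.Completion E ≃ₗᵢ[ℂ] UniformSpace.Completion E where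
  toFun := (f : E →L[ℂ] E).completion
  invFun := (f.symm : E →L[ℂ] E).completion
  map_add' := map_add _
  map_smul' := map_smul _
  left_inv x := by
    induction x using UniformSpace.Completion.induction_on with
    | hp => exact isClosed_eq (by fun_prop) continuous_id
    | ih a => simp
  right_inv x := by
    induction x using UniformSpace.Completion.induction_on with
    | hp => exact isClosed_eq (by fun_prop) continuous_id
    | ih a => simp
  norm_map' x := by
    change ‖(f : E →L[ℂ] E).completion x‖ = ‖x‖
    induction x using UniformSpace.Completion.induction_on with
    | hp => exact isClosed_eq (by fun_prop) continuous_norm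
    | ih a => simp

theorem completionIsometry_coe {E : Type*} [NormedAddCommGroup E] [InnerProductSpace ℂ E]
    (f : E ≃ₗᵢ[ℂ] E) (a : E) :
    completionIsometry f (a : UniformSpace.Completion E) = (f a : E) := by
  change (f : E →L[ℂ] E).completion (a : UniformSpace.Completion E) = _
  simp

namespace UnitaryRep

variable {G V W : Type*} [Group G] [TopologicalSpace G]
  [NormedAddCommGroup V] [InnerProductSpace ℂ V] [NormedAddCommGroup W] [InnerProductSpace ℂ W]

/-- The operator of `π ⊗ σ` at `g`. -/
noncomputable def tensorOp (π : UnitaryRep G V) (σ : UnitaryRep G W) (g : G) :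
    HilbertTensor V W ≃ₗᵢ[ℂ] HilbertTensor V W :=
  completionIsometry (TensorProduct.congrIsometry (π.toHom g) (σ.toHom g))

theorem tensorOp_htmul (π : UnitaryRep G V) (σ : UnitaryRep G W) (g : G) (v : V) (w : W) :
    tensorOp π σ g (htmul v w) = htmul (π.toHom g v) (σ.toHom g w) := by
  rw [tensorOp, htmul, completionIsometry_coe]
  simp [htmul]

theorem continuous_tensorOp_coe (π : UnitaryRep G V) (σ : UnitaryRep G W) (a : V ⊗[ℂ] W) :
    Continuous fun g => tensorOp π σ g (a : UniformSpace.Completion (V ⊗[ℂ] W)) := by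
  induction a using TensorProduct.induction_on with
  | zero => simpa only [UniformSpace.Completion.coe_zero, map_zero] using continuous_const
  | tmul v w =>
    have h : (fun g => tensorOp π σ g ((v ⊗ₜ[ℂ] w : V ⊗[ℂ] W) : UniformSpace.Completion _))
        = fun g => ((TensorProduct.mkL ℂ V W (π.toHom g v) (σ.toHom g w) : V ⊗[ℂ] W) :
            UniformSpace.Completion (V ⊗[ℂ] W)) :=
      funext fun g => tensorOp_htmul π σ g v w
    rw [h]
    refine (UniformSpace.Completion.continuous_coe _).comp ?_
    exact ((TensorProduct.mkL ℂ V W).continuous.comp (π.continuous_apply v)).clm_apply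
      (σ.continuous_apply w)
  | add a b ha hb =>
    simp only [UniformSpace.Completion.coe_add, map_add]
    exact ha.add hb

/-- The tensor product `π ⊗ σ` of two unitary representations, acting on the Hilbert space tensor
product by `g (v ⊗ w) = (π g v) ⊗ (σ g w)`. -/
noncomputable def tensor (π : UnitaryRep G V) (σ : UnitaryRep G W) :
    UnitaryRep G (HilbertTensor V W) where
  toHom :=
    { toFun := tensorOp π σ
      map_one' := by
        ext x
        induction x using UniformSpace.Completion.induction_on with
        | hp => exact isClosed_eq (tensorOp π σ 1).continuous continuous_id
        | ih a =>
          induction a using TensorProduct.induction_on with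
          | zero => simp only [UniformSpace.Completion.coe_zero, map_zero]
          | tmul v w => simpa [htmul] using tensorOp_htmul π σ 1 v w
          | add a b ha hb =>
            simp only [UniformSpace.Completion.coe_add, map_add]
            exact congrArg₂ (· + ·) ha hb
      map_mul' := fun g h => by
        ext x
        induction x using UniformSpace.Completion.induction_on with
        | hp =>
          exact isClosed_eq (tensorOp π σ (g * h)).continuous
            (tensorOp π σ g * tensorOp π σ h).continuous
        | ih a =>
          induction a using TensorProduct.induction_on with
          | zero => simp only [UniformSpace.Completion.coe_zero, map_zero]
          | tmul v w =>
            change tensorOp π σ (g * h) (htmul v w) = tensorOp π σ g (tensorOp π σ h (htmul v w))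
            simp [tensorOp_htmul]
          | add a b ha hb =>
            simp only [UniformSpace.Completion.coe_add, map_add]
            exact congrArg₂ (· + ·) ha hb }
  continuous_apply := fun x => by
    change Continuous fun g => tensorOp π σ g x
    rw [continuous_iff_continuousAt]
    intro g₀
    rw [Metric.continuousAt_iff']
    intro ε hε
    obtain ⟨_, ⟨a, rfl⟩, ha⟩ := Metric.mem_closure_iff.1
      (UniformSpace.Completion.denseRange_coe (α := V ⊗[ℂ] W) x) (ε / 3) (by positivity)
    have h := Metric.continuousAt_iff'.1
      ((continuous_tensorOp_coe π σ a).continuousAt (x := g₀)) (ε / 3) (by positivity)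
    filter_upwards [h] with g hg
    have h1 := (tensorOp π σ g).dist_map x a
    have h2 := (tensorOp π σ g₀).dist_map a x
    rw [dist_comm] at h2
    have h3 := dist_triangle4 (tensorOp π σ g x) (tensorOp π σ g a) (tensorOp π σ g₀ a)
      (tensorOp π σ g₀ x)
    rw [dist_comm (tensorOp π σ g₀ a)] at h3
    rw [dist_comm (a : UniformSpace.Completion (V ⊗[ℂ] W)) x] at h2
    linarith

/-- The trivial component of `π`: the subspace of `π`-fixed vectors. -/
def fixedSpace (π : UnitaryRep G V) : Submodule ℂ V where
  carrier := {v | ∀ g : G, π.toHom g v = v}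
  add_mem' := fun ha hb g => by rw [map_add, ha g, hb g]
  zero_mem' := fun g => map_zero _
  smul_mem' := fun c v hv g => by rw [map_smul, hv g]

theorem isClosed_fixedSpace (π : UnitaryRep G V) : IsClosed (π.fixedSpace : Set V) := by
  have h : (π.fixedSpace : Set V) = ⋂ g : G, {v | π.toHom g v = v} := by
    ext v
    simp [fixedSpace]
  rw [h]
  exact isClosed_iInter fun g => isClosed_eq (π.toHom g).continuous continuous_id

instance fixedSpace_completeSpace [CompleteSpace V] (π : UnitaryRep G V) :
    CompleteSpace π.fixedSpace :=
  π.isClosed_fixedSpace.completeSpace_coe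

/-- The orthogonal projection of `V` onto the subspace of `π`-fixed vectors. -/
noncomputable def fixedProj [CompleteSpace V] (π : UnitaryRep G V) : V →L[ℂ] V :=
  π.fixedSpace.starProjection

end UnitaryRep

open scoped InnerProductSpace ComplexConjugate

/-! ### Vectors of the tensor product as Hilbert–Schmidt operators. -/

section HilbertTensor

variable {V W : Type*} [NormedAddCommGroup V] [InnerProductSpace ℂ V]
  [NormedAddCommGroup W] [InnerProductSpace ℂ W]

/-! The difference `w` of the two projections is fixed by `π ⊗ π` and orthogonal to every tensor of
fixed vectors. Read `w` as a conjugate-linear Hilbert–Schmidt operator `T = hsOp w`, which then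
intertwines `π` with itself. If `T* T ≠ 0`, its top eigenvalue `‖T* T‖` has a finite-dimensional
invariant eigenspace. Were its dimension below `D`, quasi-randomness would make it consist of fixed
vectors, on which orthogonality forces `T` to vanish: a contradiction. So the multiplicity is at
least `D`, and comparison with the Hilbert–Schmidt norm gives `‖T* T‖ * D ≤ ‖w‖ ^ 2`
(`norm_gramOp_mul_le`). Finally `‖w‖ ^ 2 = |⟪u, T v⟫| ≤ ‖u‖ * ‖T v‖`, which is at most `D ^ (-1/2) *
‖u‖ * ‖v‖ * ‖w‖`. -/

theorem inner_htmul (x x' : V) (y y' : W) :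
    ⟪htmul x y, htmul x' y'⟫_ℂ = ⟪x, x'⟫_ℂ * ⟪y, y'⟫_ℂ := by
  simp [htmul]

/-- The elementary tensor as a continuous bilinear map. -/
noncomputable def htmulL (V W : Type*) [NormedAddCommGroup V] [InnerProductSpace ℂ V]
    [NormedAddCommGroup W] [InnerProductSpace ℂ W] : V →L[ℂ] W →L[ℂ] HilbertTensor V W :=
  (ContinuousLinearMap.compL ℂ W (V ⊗[ℂ] W) (HilbertTensor V W)
    (UniformSpace.Completion.toComplL (𝕜 := ℂ) (E := V ⊗[ℂ] W))).comp (TensorProduct.mkL ℂ V W)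

@[simp]
theorem htmulL_apply (x : V) (y : W) : htmulL V W x y = htmul x y := rfl

theorem HilbertTensor.induction_on_htmul {p : HilbertTensor V W → Prop} (hp : IsClosed {w | p w})
    (h0 : p 0) (hadd : ∀ a b, p a → p b → p (a + b)) (htm : ∀ x y, p (htmul x y))
    (w : HilbertTensor V W) : p w := by
  induction w using UniformSpace.Completion.induction_on with
  | hp => exact hp
  | ih a =>
    induction a using TensorProduct.induction_on with
    | zero => simpa only [UniformSpace.Completion.coe_zero] using h0
    | tmul x y => exact htm x y
    | add a b ha hb => simpa only [UniformSpace.Completion.coe_add] using hadd _ _ ha hb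

/-- The conjugate-linear operator `W → V` attached to a vector of the Hilbert space tensor
product `V ⊗ W`. -/
noncomputable def hsOp [CompleteSpace V] :
    HilbertTensor V W →L[ℂ] W →L⋆[ℂ] V :=
  -- The value at `y` is the adjoint of `x ↦ x ⊗ y` applied to `w`; taking adjoints is antilinear,
  -- whence conjugate-linearity in `y`.
  (((ContinuousLinearMap.adjoint (𝕜 := ℂ) (E := V)
    (F := HilbertTensor V W)).toLinearIsometry.toContinuousLinearMap).comp
    (htmulL V W).flip).flip

theorem inner_hsOp [CompleteSpace V] (w : HilbertTensor V W) (x : V) (y : W) :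
    ⟪x, hsOp w y⟫_ℂ = ⟪htmul x y, w⟫_ℂ := by
  change ⟪x, ContinuousLinearMap.adjoint ((htmulL V W).flip y) w⟫_ℂ = _
  rw [ContinuousLinearMap.adjoint_inner_right]
  rfl

/-- The conjugate-linear operator `V → W` attached to a vector of the Hilbert space tensor
product `V ⊗ W`; it is the adjoint of `hsOp`. -/
noncomputable def hsOpAdjoint [CompleteSpace W] :
    HilbertTensor V W →L[ℂ] V →L⋆[ℂ] W :=
  (((ContinuousLinearMap.adjoint (𝕜 := ℂ) (E := W)
    (F := HilbertTensor V W)).toLinearIsometry.toContinuousLinearMap).comp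
    (htmulL V W)).flip

theorem inner_hsOpAdjoint [CompleteSpace W] (w : HilbertTensor V W) (x : V) (y : W) :
    ⟪y, hsOpAdjoint w x⟫_ℂ = ⟪htmul x y, w⟫_ℂ := by
  change ⟪y, ContinuousLinearMap.adjoint (htmulL V W x) w⟫_ℂ = _
  rw [ContinuousLinearMap.adjoint_inner_right]
  rfl

theorem hsOp_htmul [CompleteSpace V] (x : V) (y z : W) :
    hsOp (htmul x y) z = ⟪z, y⟫_ℂ • x := by
  refine ext_inner_left ℂ fun a => ?_
  rw [inner_hsOp, inner_htmul, inner_smul_right, mul_comm]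

/-- Elementary tensors give operators of rank at most one, their sums are dense, and compact
operators are closed in norm. -/
theorem isCompactOperator_hsOp [CompleteSpace V] (w : HilbertTensor V W) :
    IsCompactOperator (hsOp w : W → V) := by
  refine HilbertTensor.induction_on_htmul (p := fun w => IsCompactOperator (hsOp w : W → V))
    ?_ ?_ ?_ ?_ w
  · exact (isClosed_setOfPred_isCompactOperator (σ₁₂ := starRingEnd ℂ) (M₁ := W)
      (M₂ := V)).preimage (hsOp (V := V) (W := W)).continuous
  · rw [map_zero]
    exact isCompactOperator_zero
  · intro a b ha hb
    rw [map_add]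
    exact ha.add hb
  · intro x y
    have h : (hsOp (htmul x y) : W → V) =
        (fun c : ℂ => conj c • x) ∘ (innerSL ℂ y : W → ℂ) := by
      ext z
      simp [hsOp_htmul]
    rw [h]
    exact (isCompactOperator_of_locallyCompactSpace_dom (innerSL ℂ y)).continuous_comp
      (by fun_prop)

/-- Bessel's inequality for the Hilbert-Schmidt norm, along a finite orthonormal family whose
images all have the same norm. -/
theorem sum_norm_sq_hsOp_le [CompleteSpace V] (w : HilbertTensor V W) {ι : Type*} [Fintype ι]
    {e : ι → W} (he : Orthonormal ℂ e) {c : ℝ} (hc : 0 < c)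
    (hnorm : ∀ i, ‖hsOp w (e i)‖ ^ 2 = c) :
    Fintype.card ι * c ≤ ‖w‖ ^ 2 := by
  classical
  set s := Real.sqrt c
  have hs : 0 < s := Real.sqrt_pos.2 hc
  have hn : ∀ i, ‖hsOp w (e i)‖ = s := fun i => by
    rw [← Real.sqrt_sq (norm_nonneg (hsOp w (e i))), hnorm i]
  -- Pairing each `e i` with its normalized image gives an orthonormal family whose coefficients
  -- against `w` have modulus `‖hsOp w (e i)‖`.
  set f : ι → HilbertTensor V W := fun i => htmul ((s⁻¹ : ℂ) • hsOp w (e i)) (e i)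
  have hf : Orthonormal ℂ f := by
    rw [orthonormal_iff_ite] at he ⊢
    intro i j
    rw [inner_htmul, he i j]
    split_ifs with hij
    · subst hij
      rw [mul_one, inner_self_eq_norm_sq_to_K, norm_smul, hn]
      simp [abs_of_pos hs, hs.ne']
    · simp
  have hin : ∀ i, ‖⟪f i, w⟫_ℂ‖ ^ 2 = c := fun i => by
    rw [← inner_hsOp, inner_smul_left, inner_self_eq_norm_sq_to_K, hn]
    simp only [map_inv₀, Complex.conj_ofReal, norm_mul, norm_inv, Complex.norm_real, norm_pow,
      Complex.coe_algebraMap, Real.norm_eq_abs, abs_of_pos hs]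
    rw [pow_two s, inv_mul_cancel_left₀ hs.ne', Real.sq_sqrt hc.le]
  have := hf.sum_inner_products_le (s := Finset.univ) (x := w)
  simpa [hin] using this

/-- The positive operator `T* T` for `T = hsOp w`. -/
noncomputable def gramOp [CompleteSpace V] [CompleteSpace W] (w : HilbertTensor V W) :
    W →L[ℂ] W :=
  (hsOpAdjoint w).comp (hsOp w)

theorem inner_gramOp [CompleteSpace V] [CompleteSpace W] (w : HilbertTensor V W) (y z : W) :
    ⟪y, gramOp w z⟫_ℂ = ⟪hsOp w z, hsOp w y⟫_ℂ := by
  rw [inner_hsOp]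
  exact inner_hsOpAdjoint w _ _

theorem isSymmetric_gramOp [CompleteSpace V] [CompleteSpace W] (w : HilbertTensor V W) :
    (gramOp w).IsSymmetric := fun y z => by
  change ⟪gramOp w y, z⟫_ℂ = ⟪y, gramOp w z⟫_ℂ
  rw [inner_gramOp, ← inner_conj_symm, inner_gramOp, inner_conj_symm]

theorem isCompactOperator_gramOp [CompleteSpace V] [CompleteSpace W] (w : HilbertTensor V W) :
    IsCompactOperator (gramOp w) :=
  (isCompactOperator_hsOp w).continuous_comp (hsOpAdjoint w).continuous

theorem norm_hsOp_sq_le [CompleteSpace V] [CompleteSpace W] (w : HilbertTensor V W) (y : W) :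
    ‖hsOp w y‖ ^ 2 ≤ ‖gramOp w‖ * ‖y‖ ^ 2 := by
  have h := congrArg norm (inner_gramOp w y y)
  rw [inner_self_eq_norm_sq_to_K] at h
  simp only [Complex.coe_algebraMap, norm_pow, Complex.norm_real, norm_norm] at h
  rw [← h]
  calc _ ≤ ‖y‖ * ‖gramOp w y‖ := norm_inner_le_norm _ _
    _ ≤ ‖y‖ * (‖gramOp w‖ * ‖y‖) := by gcongr; exact (gramOp w).le_opNorm y
    _ = _ := by ring

theorem norm_hsOp_sq_of_mem_eigenspace [CompleteSpace V] [CompleteSpace W]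
    (w : HilbertTensor V W) {c : ℝ} {y : W}
    (hy : gramOp w y = (c : ℂ) • y) : ‖hsOp w y‖ ^ 2 = c * ‖y‖ ^ 2 := by
  have h := inner_gramOp w y y
  rw [hy, inner_smul_right, inner_self_eq_norm_sq_to_K, inner_self_eq_norm_sq_to_K] at h
  exact Complex.ofReal_injective (by push_cast; exact h.symm)

/-- Self-adjointness puts a point of modulus equal to the norm in the spectrum, compactness makes it
an eigenvalue, and positivity makes it equal to its modulus. -/
theorem hasEigenvalue_norm_gramOp [CompleteSpace V] [CompleteSpace W] (w : HilbertTensor V W)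
    (hw : gramOp w ≠ 0) :
    Module.End.HasEigenvalue (gramOp w : W →ₗ[ℂ] W) (‖gramOp w‖ : ℂ) := by
  have : Nontrivial W := by
    by_contra h
    rw [not_nontrivial_iff_subsingleton] at h
    exact hw (Subsingleton.elim _ _)
  have hsa : IsSelfAdjoint (gramOp w) := (isSymmetric_gramOp w).isSelfAdjoint
  obtain ⟨k, hk, hk'⟩ := spectrum.exists_nnnorm_eq_spectralRadius (gramOp w)
  rw [(gramOp w).spectralRadius_eq_nnnorm hsa, ENNReal.coe_inj] at hk'
  replace hk' : ‖k‖ = ‖gramOp w‖ := congrArg NNReal.toReal hk'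
  have hk0 : k ≠ 0 := by
    rw [← norm_ne_zero_iff, hk', norm_ne_zero_iff]
    exact hw
  have hev := ((isCompactOperator_gramOp w).hasEigenvalue_iff_mem_spectrum hk0).2 hk
  obtain ⟨y, hy⟩ := hev.exists_hasEigenvector
  have hy1 : gramOp w y = k • y := hy.apply_eq_smul
  have h := inner_gramOp w y y
  rw [hy1, inner_smul_right, inner_self_eq_norm_sq_to_K, inner_self_eq_norm_sq_to_K] at h
  have hyn : (‖y‖ : ℝ) ^ 2 ≠ 0 := pow_ne_zero 2 (norm_ne_zero_iff.2 hy.2)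
  have hkr : k = ((‖hsOp w y‖ ^ 2 / ‖y‖ ^ 2 : ℝ) : ℂ) := by
    have : ((‖y‖ ^ 2 : ℝ) : ℂ) ≠ 0 := by exact_mod_cast hyn
    rw [Complex.ofReal_div, eq_div_iff this]
    exact_mod_cast h
  have hkk : k = (‖k‖ : ℂ) := by
    rw [hkr, Complex.norm_real, Real.norm_of_nonneg (by positivity)]
  rw [← hk', ← hkk]
  exact hev

end HilbertTensor

/-! ### Quasi-randomness and intertwining operators. -/

namespace UnitaryRep

variable {G V W : Type*} [Group G] [TopologicalSpace G]
  [NormedAddCommGroup V] [InnerProductSpace ℂ V] [NormedAddCommGroup W] [InnerProductSpace ℂ W]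

theorem mem_fixedSpace {π : UnitaryRep G V} {v : V} :
    v ∈ π.fixedSpace ↔ ∀ g : G, π.toHom g v = v := Iff.rfl

theorem inner_toHom_left (π : UnitaryRep G V) (g : G) (x y : V) :
    ⟪π.toHom g x, y⟫_ℂ = ⟪x, π.toHom g⁻¹ y⟫_ℂ := by
  have h : π.toHom g (π.toHom g⁻¹ y) = y := by
    change (π.toHom g * π.toHom g⁻¹) y = y
    rw [← map_mul, mul_inv_cancel, map_one]
    rfl
  rw [← (π.toHom g).inner_map_map x, h]

theorem tensor_toHom_htmul (π : UnitaryRep G V) (σ : UnitaryRep G W) (g : G) (v : V) (w : W) :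
    (π.tensor σ).toHom g (htmul v w) = htmul (π.toHom g v) (σ.toHom g w) :=
  tensorOp_htmul π σ g v w

/-- The action of `G` on an invariant subspace, as a homomorphism to its endomorphisms. -/
def restrictHom (π : UnitaryRep G V) (E : Submodule ℂ V)
    (hE : ∀ g : G, ∀ x ∈ E, π.toHom g x ∈ E) : G →* Module.End ℂ E where
  toFun g := ((π.toHom g).toLinearEquiv : V →ₗ[ℂ] V).restrict (hE g)
  map_one' := by
    ext x
    simp
  map_mul' g h := by
    ext x
    simp

/-- An invariant subspace of dimension less than `D` consists of fixed vectors. -/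
theorem le_fixedSpace_of_finrank_lt [IsTopologicalGroup G] {D : ℝ} (hG : IsQuasiRandom G D)
    (π : UnitaryRep G V) (E : Submodule ℂ V) [FiniteDimensional ℂ E]
    (hE : ∀ g : G, ∀ x ∈ E, π.toHom g x ∈ E) (hdim : (Module.finrank ℂ E : ℝ) < D) :
    E ≤ π.fixedSpace := by
  let b := stdOrthonormalBasis ℂ E
  let m : G →* Matrix (Fin (Module.finrank ℂ E)) (Fin (Module.finrank ℂ E)) ℂ :=
    ((LinearMap.toMatrixAlgEquiv b.toBasis : Module.End ℂ E →* _)).comp (π.restrictHom E hE)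
  have hm : Continuous m := by
    refine continuous_matrix fun i j => ?_
    have h : (fun g => m g i j) = fun g => ⟪(b i : V), π.toHom g (b j)⟫_ℂ := by
      ext g
      change LinearMap.toMatrixAlgEquiv b.toBasis (π.restrictHom E hE g) i j = _
      rw [LinearMap.toMatrixAlgEquiv_apply, OrthonormalBasis.coe_toBasis,
        OrthonormalBasis.coe_toBasis_repr_apply, OrthonormalBasis.repr_apply_apply]
      rfl
    rw [h]
    exact continuous_const.inner (π.continuous_apply _)
  -- The topology on units also demands continuity of the inverse, which comes from inversion in
  -- `G`.
  have hcont : Continuous m.toHomUnits := by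
    refine Units.continuous_iff.2 ⟨hm, ?_⟩
    have h : (fun g => (((m.toHomUnits g)⁻¹ : (Matrix _ _ ℂ)ˣ) : Matrix _ _ ℂ)) =
        fun g => m g⁻¹ := by
      ext1 g
      rw [← map_inv]
      rfl
    exact h ▸ hm.comp continuous_inv
  have h1 := hG _ hdim m.toHomUnits hcont
  intro x hx g
  have h2 : m g = 1 := congrArg Units.val (DFunLike.congr_fun h1 g)
  have h3 : π.restrictHom E hE g = 1 :=
    (LinearMap.toMatrixAlgEquiv b.toBasis).injective (h2.trans (map_one _).symm)
  exact congrArg Subtype.val (LinearMap.congr_fun h3 ⟨x, hx⟩)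

section Intertwiner

variable [CompleteSpace V] {π : UnitaryRep G V} {σ : UnitaryRep G W} {w : HilbertTensor V W}

omit [CompleteSpace V] in
theorem inner_htmul_toHom (hw : w ∈ (π.tensor σ).fixedSpace) (g : G) (x : V) (y : W) :
    ⟪htmul (π.toHom g x) (σ.toHom g y), w⟫_ℂ = ⟪htmul x y, w⟫_ℂ := by
  rw [← tensor_toHom_htmul, inner_toHom_left, hw]

/-- Invariance of `w` becomes equivariance of its operator; conjugate-linearity avoids passing to a
dual representation. -/
theorem hsOp_toHom (hw : w ∈ (π.tensor σ).fixedSpace) (g : G) (y : W) :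
    hsOp w (σ.toHom g y) = π.toHom g (hsOp w y) := by
  refine ext_inner_left ℂ fun x => ?_
  obtain ⟨x, rfl⟩ := (π.toHom g).surjective x
  rw [LinearIsometryEquiv.inner_map_map, inner_hsOp, inner_hsOp, inner_htmul_toHom hw]

theorem gramOp_toHom [CompleteSpace W] (hw : w ∈ (π.tensor σ).fixedSpace) (g : G) (y : W) :
    gramOp w (σ.toHom g y) = σ.toHom g (gramOp w y) := by
  refine ext_inner_left ℂ fun x => ?_
  obtain ⟨x, rfl⟩ := (σ.toHom g).surjective x
  rw [LinearIsometryEquiv.inner_map_map, inner_gramOp, inner_gramOp, hsOp_toHom hw,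
    hsOp_toHom hw, LinearIsometryEquiv.inner_map_map]

/-- The operator attached to a fixed vector orthogonal to the tensors of fixed vectors has small
norm. -/
theorem norm_gramOp_mul_le [CompleteSpace W] [IsTopologicalGroup G] {D : ℝ}
    (hG : IsQuasiRandom G D) (hw : w ∈ (π.tensor σ).fixedSpace)
    (hw' : ∀ a ∈ π.fixedSpace, ∀ b ∈ σ.fixedSpace, ⟪htmul a b, w⟫_ℂ = 0) :
    ‖gramOp w‖ * D ≤ ‖w‖ ^ 2 := by
  by_cases h0 : gramOp w = 0
  · simp [h0]
  have hpos : 0 < ‖gramOp w‖ := norm_pos_iff.2 h0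
  have hev := hasEigenvalue_norm_gramOp w h0
  set E := Module.End.eigenspace (gramOp w : W →ₗ[ℂ] W) (‖gramOp w‖ : ℂ) with hE
  have hmem : ∀ {y}, y ∈ E ↔ gramOp w y = (‖gramOp w‖ : ℂ) • y :=
    Module.End.mem_eigenspace_iff
  have hfin : FiniteDimensional ℂ E :=
    ContinuousLinearMap.finite_dimensional_eigenspace (isCompactOperator_gramOp w) _
      (by exact_mod_cast hpos.ne')
  have hinv : ∀ g : G, ∀ y ∈ E, σ.toHom g y ∈ E := fun g y hy => by
    rw [hmem] at hy ⊢
    rw [gramOp_toHom hw, hy, map_smul]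
  have hdim : D ≤ Module.finrank ℂ E := by
    by_contra! hlt
    have hle := σ.le_fixedSpace_of_finrank_lt hG E hinv hlt
    obtain ⟨y, hy⟩ := hev.exists_hasEigenvector
    have hyE : y ∈ E := hy.1
    -- Both `y` and its image are fixed, so their tensor is orthogonal to `w`; that pairing is
    -- `‖hsOp w y‖ ^ 2`, which a positive eigenvalue keeps nonzero.
    have hTy : hsOp w y ∈ π.fixedSpace := fun g => by
      rw [← hsOp_toHom hw, hle hyE g]
    have h := hw' _ hTy _ (hle hyE)
    rw [← inner_hsOp, inner_self_eq_zero] at h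
    have h' := norm_hsOp_sq_of_mem_eigenspace w (hmem.1 hyE)
    rw [h, norm_zero, zero_pow two_ne_zero] at h'
    have hyn : 0 < ‖y‖ := norm_pos_iff.2 hy.2
    have : 0 < ‖gramOp w‖ * ‖y‖ ^ 2 := by positivity
    exact this.ne h'
  let b := stdOrthonormalBasis ℂ E
  have hb : Orthonormal ℂ fun i => (b i : W) := b.orthonormal.comp_linearIsometry E.subtypeₗᵢ
  have h := sum_norm_sq_hsOp_le w hb hpos fun i => by
    rw [norm_hsOp_sq_of_mem_eigenspace w (hmem.1 (b i).2), hb.1 i, one_pow, mul_one]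
  rw [Fintype.card_fin] at h
  calc ‖gramOp w‖ * D ≤ ‖gramOp w‖ * Module.finrank ℂ E := by gcongr
    _ = Module.finrank ℂ E * ‖gramOp w‖ := mul_comm _ _
    _ ≤ _ := h

end Intertwiner

theorem fixedProj_mem [CompleteSpace V] (π : UnitaryRep G V) (v : V) :
    π.fixedProj v ∈ π.fixedSpace :=
  Submodule.starProjection_apply_mem _ _

theorem inner_fixedProj_of_mem [CompleteSpace V] (π : UnitaryRep G V) {a : V}
    (ha : a ∈ π.fixedSpace) (v : V) : ⟪a, π.fixedProj v⟫_ℂ = ⟪a, v⟫_ℂ := by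
  rw [fixedProj, ← Submodule.inner_starProjection_left_eq_right,
    Submodule.starProjection_eq_self_iff.2 ha]

end UnitaryRep

/-! ### The main estimate. -/

open UnitaryRep in
theorem lemma2 {G : Type*} [Group G] [TopologicalSpace G] [IsTopologicalGroup G] [CompactSpace G]
    {D : ℝ} (hD : 0 < D) (hG : IsQuasiRandom G D)
    {V : Type*} [NormedAddCommGroup V] [InnerProductSpace ℂ V] [CompleteSpace V]
    (π : UnitaryRep G V) (u v : V) :
    ‖(π.tensor π).fixedProj (htmul u v) - htmul (π.fixedProj u) (π.fixedProj v)‖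
      ≤ D ^ (-(1 / 2) : ℝ) * ‖u‖ * ‖v‖ := by
  set w := (π.tensor π).fixedProj (htmul u v) - htmul (π.fixedProj u) (π.fixedProj v) with hwdef
  have hfix : w ∈ (π.tensor π).fixedSpace :=
    Submodule.sub_mem _ ((π.tensor π).fixedProj_mem _) fun g => by
      rw [tensor_toHom_htmul, π.fixedProj_mem u g, π.fixedProj_mem v g]
  have horth : ∀ a ∈ π.fixedSpace, ∀ b ∈ π.fixedSpace, ⟪htmul a b, w⟫_ℂ = 0 := by
    intro a ha b hb
    have hab : htmul a b ∈ (π.tensor π).fixedSpace := fun g => by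
      rw [tensor_toHom_htmul, ha g, hb g]
    rw [hwdef, inner_sub_right, inner_fixedProj_of_mem _ hab, inner_htmul, inner_htmul,
      inner_fixedProj_of_mem _ ha, inner_fixedProj_of_mem _ hb, sub_self]
  have hle := norm_gramOp_mul_le hG hfix horth
  -- As `w` is fixed, the projection can be dropped, and `w` is orthogonal to the subtracted tensor
  -- of fixed vectors.
  have hww : ⟪w, w⟫_ℂ = ⟪w, htmul u v⟫_ℂ := by
    conv_lhs => rw [hwdef]
    rw [inner_sub_right, inner_fixedProj_of_mem _ hfix, ← inner_conj_symm w (htmul (π.fixedProj u) _),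
      horth _ (π.fixedProj_mem u) _ (π.fixedProj_mem v), map_zero, sub_zero]
  have hsq : ‖w‖ ^ 2 ≤ ‖u‖ * ‖hsOp w v‖ := by
    have h := congrArg norm hww
    rw [inner_self_eq_norm_sq_to_K, ← inner_conj_symm w, ← inner_hsOp, RCLike.norm_conj] at h
    simp only [Complex.coe_algebraMap, norm_pow, Complex.norm_real, norm_norm] at h
    rw [h]
    exact norm_inner_le_norm _ _
  have hT := norm_hsOp_sq_le w v
  have hsD : D ^ (-(1 / 2) : ℝ) = (Real.sqrt D)⁻¹ := by
    rw [Real.rpow_neg hD.le, Real.sqrt_eq_rpow]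
  have hs : 0 < Real.sqrt D := Real.sqrt_pos.2 hD
  have hTs : ‖hsOp w v‖ * Real.sqrt D ≤ ‖w‖ * ‖v‖ := by
    refine le_of_sq_le_sq ?_ (by positivity)
    rw [mul_pow, mul_pow, Real.sq_sqrt hD.le]
    calc ‖hsOp w v‖ ^ 2 * D ≤ ‖gramOp w‖ * ‖v‖ ^ 2 * D := by gcongr
      _ = ‖gramOp w‖ * D * ‖v‖ ^ 2 := by ring
      _ ≤ ‖w‖ ^ 2 * ‖v‖ ^ 2 := by gcongr
  rw [hsD, mul_assoc, inv_mul_eq_div, le_div_iff₀ hs]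
  -- The bounds are quadratic in `w`, so one factor `‖w‖` has to be cancelled.
  rcases (norm_nonneg w).eq_or_lt with h0 | hpos
  · rw [← h0, zero_mul]
    positivity
  · refine le_of_mul_le_mul_left ?_ hpos
    calc ‖w‖ * (‖w‖ * √D) = ‖w‖ ^ 2 * √D := by ring
      _ ≤ ‖u‖ * ‖hsOp w v‖ * √D := by gcongr
      _ = ‖u‖ * (‖hsOp w v‖ * √D) := by ring
      _ ≤ ‖u‖ * (‖w‖ * ‖v‖) := by gcongr
      _ = ‖w‖ * (‖u‖ * ‖v‖) := by ring
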